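/- **Theorem 8 (Asymptotic exactness of multivariate Cheap Bootstrap).** Let $d\ge 1$ and $B\ge d$ be integers and $\alpha\in(0,1)$. Let $X_1,X_2,\dots$ be i.i.d. with distribution $P$ on a measurable space, and let $\psi(\cdot)$ be an $\mathbb R^d$-valued functional on probability distributions such that $\psi\big(\tfrac1n\sum_{i\le n}\delta_{x_i}\big)$ is a measurable function of $(x_1,\dots,x_n)$ for every $n\ge1$. Write $\psi=\psi(P)$, $\hat P_n=\frac1n\sum_{i=1}^n\delta_{X_i}$ and $\hat\psi_n=\psi(\hat P_n)$. For each $n$ and $b=1,\dots,B$ let $X_1^{*b},\dots,X_n^{*b}$ be drawn uniformly with replacement from $\{X_1,\dots,X_n\}$, all $nB$ draws being independent of each other and of the data (in terms of the indices drawn), and let $\psi_n^{*b}=\psi\big(\frac1n\sum_{i=1}^n\delta_{X_i^{*b}}\big)$. Assume that for some positive definite $\Sigma\in\mathbb R^{d\times d}$, as $n\to\infty$, $\sqrt n(\hat\psi_n-\psi)\Rightarrow N(0,\Sigma)$, and for a resample estimate $\psi_n^*$ (each $\psi_n^{*b}$) $\sqrt n(\psi_n^{*}-\hat\psi_n)\Rightarrow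 N(0,\Sigma)$ conditionally on the data in probability, i.e., for every $x\in\mathbb R^d$, with componentwise inequalities, $$\mathbb P\big(\sqrt n(\psi_n^{*}-\hat\psi_n)\le x\,\big|\,X_1,\dots,X_n\big)\ \xrightarrow{\ p\ }\ \mathbb P\big(N(0,\Sigma)\le x\big).$$ Let $S=\frac1B\sum_{b=1}^B(\psi_n^{*b}-\hat\psi_n)(\psi_n^{*b}-\hat\psi_n)^\top$, and let $T^2_{d,B,1-\alpha}$ be the $(1-\alpha)$-quantile of Hotelling's $T^2$ distribution with parameters $d$ and $B$, that is, of the law of $Z_0^\top\big(\frac1B\sum_{b=1}^BZ_bZ_b^\top\big)^{-1}Z_0$ with $Z_0,\dots,Z_B$ i.i.d. $N(0,I_d)$. Then, as $n\to\infty$, $S$ is invertible with probability tending to $1$, and the region $$\mathcal R=\big\{\theta\in\mathbb R^d:(\hat\psi_n-\theta)^\top S^{-1}(\hat\psi_n-\theta)\le T^2_{d,B,1-\alpha}\big\}$$ is an asymptotically exact $(1-\alpha)$-level confidence region for $\psi$: $$\mathbb P_n(\psi\in\mathcal R)\to1-\alpha,$$ where $\mathbb P_n$ is the probability with respect to the data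 and all randomness of the resampling. (When $S$ is singular, $S^{-1}$ is read as $0$; by the preceding assertion this does not affect the limit.) -/

import Mathlib

open MeasureTheory ProbabilityTheory Filter
open scoped Topology ENNReal Matrix

noncomputable section

namespace CheapBootstrap

/-- The empirical distribution `n⁻¹ ∑ᵢ δ_{xᵢ}` of the points `x₀, …, xₙ₋₁`, `n ≥ 1`. -/
def empirical {𝒳 : Type*} [MeasurableSpace 𝒳] {n : ℕ+} (x : Fin n → 𝒳) :
    ProbabilityMeasure 𝒳 :=
  ⟨((n : ℕ) : ℝ≥0∞)⁻¹ • ∑ i, Measure.dirac (x i), ⟨by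
    have h0 : ((n : ℕ) : ℝ≥0∞) ≠ 0 := Nat.cast_ne_zero.mpr n.ne_zero
    simp [ENNReal.inv_mul_cancel h0 (ENNReal.natCast_ne_top _)]⟩⟩

/-- The original data set of size `n`, as a random point of `𝒳ⁿ`. -/
def data {𝒳 Ω : Type*} (X : ℕ → Ω → 𝒳) (n : ℕ+) (ω : Ω) : Fin n → 𝒳 :=
  fun i => X i ω

/-- The σ-algebra generated by the first `n` data points. -/
abbrev dataSigma {𝒳 Ω : Type*} [MeasurableSpace 𝒳] (X : ℕ → Ω → 𝒳) (n : ℕ+) :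
    MeasurableSpace Ω :=
  MeasurableSpace.comap (data X n) inferInstance

/-- The point estimate: the functional `ψ` evaluated at the empirical distribution. -/
def estimate {𝒳 Ω : Type*} [MeasurableSpace 𝒳] {d : ℕ}
    (ψ : ProbabilityMeasure 𝒳 → EuclideanSpace ℝ (Fin d)) (X : ℕ → Ω → 𝒳)
    (n : ℕ+) (ω : Ω) : EuclideanSpace ℝ (Fin d) :=
  ψ (empirical (data X n ω))

/-- The `b`-th resample estimate: `ψ` evaluated at the empirical distribution of the resample
whose `i`-th point is the data point with index `J n b i`. -/
def resampleEstimate {𝒳 Ω : Type*} [MeasurableSpace 𝒳] {d B : ℕ}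
    (ψ : ProbabilityMeasure 𝒳 → EuclideanSpace ℝ (Fin d)) (X : ℕ → Ω → 𝒳)
    (J : (n : ℕ+) → Fin B → Fin n → Ω → Fin n)
    (n : ℕ+) (b : Fin B) (ω : Ω) : EuclideanSpace ℝ (Fin d) :=
  ψ (empirical fun i : Fin n => data X n ω (J n b i ω))

/-- For every sample size `n`, the resampling indices `J n b i` (`b < B`, `i < n`) describe `B`
resamples with replacement: they are independent, uniform on `{0, …, n - 1}`, and jointly
independent of the data `X₀, …, Xₙ₋₁`. -/
structure IsResampling {𝒳 Ω : Type*} [MeasurableSpace 𝒳] [MeasurableSpace Ω] {B : ℕ}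
    (μ : Measure Ω) (X : ℕ → Ω → 𝒳) (J : (n : ℕ+) → Fin B → Fin n → Ω → Fin n) : Prop where
  measurable : ∀ (n : ℕ+) b i, Measurable (J n b i)
  uniform : ∀ (n : ℕ+) b i, μ.map (J n b i) = uniformOn Set.univ
  indep : ∀ n : ℕ+, iIndepFun (fun (p : Fin B × Fin n) => J n p.1 p.2) μ
  indep_data : ∀ n : ℕ+, IndepFun (data X n) (fun ω (p : Fin B × Fin n) => J n p.1 p.2 ω) μ

/-- Convergence in distribution to `ν`, conditionally given the σ-algebras `𝒢 n`, in probability: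
the conditional distribution function of `Y n` given `𝒢 n` converges in probability, at every
point, to the distribution function of `ν`. (For limits `ν` whose distribution function is
continuous, such as nondegenerate normal distributions.) -/
def CondTendstoInDistribution {Ω : Type*} [MeasurableSpace Ω] {d : ℕ} (μ : Measure Ω)
    (Y : ℕ+ → Ω → EuclideanSpace ℝ (Fin d)) (𝒢 : ℕ+ → MeasurableSpace Ω)
    (ν : Measure (EuclideanSpace ℝ (Fin d))) : Prop :=
  ∀ x : EuclideanSpace ℝ (Fin d),
    TendstoInMeasure μ (fun n => μ⟦{ω | ∀ i, Y n ω i ≤ x i} | 𝒢 n⟧) atTop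
      (fun _ => ν.real {z | ∀ i, z i ≤ x i})

/-- The second-moment matrix `B⁻¹ ∑_b v_b v_bᵀ` of the vectors `v_b`. -/
def secondMoment {d B : ℕ} (v : Fin B → EuclideanSpace ℝ (Fin d)) : Matrix (Fin d) (Fin d) ℝ :=
  (B : ℝ)⁻¹ • ∑ b, Matrix.vecMulVec (v b).ofLp (v b).ofLp

/-- The quadratic form `uᵀ M⁻¹ u`. -/
def invForm {d : ℕ} (M : Matrix (Fin d) (Fin d) ℝ) (u : EuclideanSpace ℝ (Fin d)) : ℝ :=
  u.ofLp ⬝ᵥ (M⁻¹ *ᵥ u.ofLp)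

/-- Hotelling's `T²` distribution with parameters `d` and `B`: the law of
`B · Z₀ᵀ W⁻¹ Z₀ = Z₀ᵀ (B⁻¹ W)⁻¹ Z₀`, where `W = ∑_b Z_b Z_bᵀ` (a Wishart matrix with `B` degrees
of freedom) and `Z₀, Z₁, …, Z_B` are independent standard normal vectors in `ℝᵈ`. -/
def hotelling (d B : ℕ) : Measure ℝ :=
  ((stdGaussian (EuclideanSpace ℝ (Fin d))).prod
      (Measure.pi fun _ : Fin B => stdGaussian (EuclideanSpace ℝ (Fin d)))).map
    fun z => invForm (secondMoment z.2) z.1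

/-- The `p`-quantile `inf {x | μ (-∞, x] ≥ p}` of a probability measure on `ℝ`, `0 < p < 1`. -/
def quantile (μ : Measure ℝ) (p : ℝ) : ℝ :=
  sInf {x : ℝ | p ≤ μ.real (Set.Iic x)}

/-- The resample covariance matrix, centered at the point estimate. -/
def resampleCov {𝒳 Ω : Type*} [MeasurableSpace 𝒳] {d B : ℕ}
    (ψ : ProbabilityMeasure 𝒳 → EuclideanSpace ℝ (Fin d)) (X : ℕ → Ω → 𝒳)
    (J : (n : ℕ+) → Fin B → Fin n → Ω → Fin n) (n : ℕ+) (ω : Ω) : Matrix (Fin d) (Fin d) ℝ :=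
  secondMoment fun b : Fin B => resampleEstimate ψ X J n b ω - estimate ψ X n ω

/-- The Cheap Bootstrap confidence region of nominal level `1 - α`. -/
def region {𝒳 Ω : Type*} [MeasurableSpace 𝒳] {d B : ℕ}
    (ψ : ProbabilityMeasure 𝒳 → EuclideanSpace ℝ (Fin d)) (X : ℕ → Ω → 𝒳)
    (J : (n : ℕ+) → Fin B → Fin n → Ω → Fin n) (α : ℝ) (n : ℕ+) (ω : Ω) :
    Set (EuclideanSpace ℝ (Fin d)) :=
  {θ | invForm (resampleCov ψ X J n ω) (estimate ψ X n ω - θ) ≤ quantile (hotelling d B) (1 - α)}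

end CheapBootstrap

end

/-! Write `U` for the centered estimate and `D b` for the centered resample estimates, all scaled by
`√n`. Given the data, `U` is fixed and the `D b` are independent, so the joint distribution function
is the integral, over the event `U ≤ x`, of the product of the conditional distribution functions of
the `D b`. These lie in `[0, 1]` and converge in probability to constants; hence their product
converges in `L¹` to a constant, and the joint distribution function tends to that of `B + 1`
independent normal vectors (`tendsto_setIntegral_prod`, `tendstoInDistribution_estimates`).

The statistic does not change when one invertible matrix is applied to all `B + 1` vectors. This
removes the factor `√n`, and it removes the covariance from the limit, which becomes Hotelling's law
(`invForm_secondMoment_mulVec`, `map_invForm_jointLimit`).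

It remains to pass to the limit for two events, which requires their frontiers to be null. The
statistic is continuous where the second-moment matrix is nonsingular, and this holds almost surely
in the limit because `B ≥ d` Gaussian vectors span the space (`ae_span_eq_top`). Given a positive
definite second-moment matrix, the statistic is a positive definite quadratic form in an independent
Gaussian vector, so its law has no atoms (`stdGaussian_quadric`). Absence of atoms also makes the
limit probability at the quantile exactly `1 - α`. -/

namespace CheapBootstrap

/-! ### Distribution functions and weak convergence in several dimensions. -/

section Orthants

lemma isPiSystem_range_Iic_pi {κ : Type*} : IsPiSystem (Set.range (Set.Iic : (κ → ℝ) → Set (κ → ℝ))) := by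
  rintro _ ⟨a, rfl⟩ _ ⟨b, rfl⟩ -
  exact ⟨a ⊓ b, Set.Iic_inter_Iic.symm⟩

variable {κ : Type*} [Fintype κ]

/-- Convergence of distribution functions at every point implies convergence on half-open boxes. -/
lemma tendsto_measureReal_box {ι : Type*} {l : Filter ι} {ν' : ι → Measure (κ → ℝ)}
    {ν : Measure (κ → ℝ)} [∀ i, IsProbabilityMeasure (ν' i)] [IsProbabilityMeasure ν]
    (h : ∀ x, Tendsto (fun i => (ν' i).real (Set.Iic x)) l (𝓝 (ν.real (Set.Iic x))))
    {a b : κ → ℝ} (hab : a ≤ b) :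
    Tendsto (fun i => (ν' i).real (Set.univ.pi fun k => Set.Ioc (a k) (b k))) l
      (𝓝 (ν.real (Set.univ.pi fun k => Set.Ioc (a k) (b k)))) := by
  classical
  -- The box is `Iic b` minus the orthants whose corner has one coordinate lowered from `b k` to `a
  -- k`. Orthants form a π-system, so inclusion-exclusion handles their finite union.
  let t : Finset (Set (κ → ℝ)) :=
    Finset.univ.image fun k => Set.Iic (Function.update b k (a k))
  have ht : ∀ s ∈ t, s ∈ Set.range (Set.Iic : (κ → ℝ) → Set (κ → ℝ)) := by
    intro s hs
    obtain ⟨k, -, rfl⟩ := Finset.mem_image.1 hs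
    exact ⟨_, rfl⟩
  have hmeas : ∀ s ∈ Set.range (Set.Iic : (κ → ℝ) → Set (κ → ℝ)), MeasurableSet s := by
    rintro _ ⟨x, rfl⟩
    exact measurableSet_Iic
  have hunion := isPiSystem_range_Iic_pi.tendsto_measureReal_biUnion (μ := ν') (ν := ν) (l := l)
    ht hmeas (by rintro _ ⟨x, rfl⟩; exact h x)
  have hsub : (⋃ s ∈ t, s) ⊆ Set.Iic b := by
    refine Set.iUnion₂_subset fun s hs => ?_
    obtain ⟨k, -, rfl⟩ := Finset.mem_image.1 hs
    exact Set.Iic_subset_Iic.2 (_root_.update_le_iff.2 ⟨hab k, fun _ _ => le_rfl⟩)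
  have hbox : (Set.univ.pi fun k => Set.Ioc (a k) (b k)) = Set.Iic b \ ⋃ s ∈ t, s := by
    ext z
    simp only [t, Set.mem_pi, Set.mem_univ, true_imp_iff, Set.mem_Ioc, Finset.mem_image,
      Finset.mem_univ, true_and, Set.iUnion_exists, Set.iUnion_iUnion_eq', Set.mem_sdiff,
      Set.mem_Iic, Set.mem_iUnion, not_exists, le_update_iff, not_and]
    constructor
    · exact fun hz => ⟨fun k => (hz k).2, fun k hk => absurd hk (not_le.2 (hz k).1)⟩
    · exact fun hz k => ⟨not_le.1 fun hk => hz.2 k hk fun j _ => hz.1 j, hz.1 k⟩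
  have hmu : MeasurableSet (⋃ s ∈ t, s) :=
    Finset.measurableSet_biUnion _ fun s hs => hmeas s (ht s hs)
  have hsdiff : ∀ (m : Measure (κ → ℝ)) [IsProbabilityMeasure m],
      m.real (Set.Iic b \ ⋃ s ∈ t, s) = m.real (Set.Iic b) - m.real (⋃ s ∈ t, s) :=
    fun m _ => measureReal_sdiff hsub hmu
  simp_rw [hbox, hsdiff]
  exact (h b).sub hunion

/-- Convergence of distribution functions at every point implies weak convergence. -/
lemma tendsto_probabilityMeasure_of_tendsto_Iic {ι : Type*} {l : Filter ι}
    [l.IsCountablyGenerated] {ν' : ι → ProbabilityMeasure (κ → ℝ)} {ν : ProbabilityMeasure (κ → ℝ)}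
    (h : ∀ x, Tendsto (fun i => (ν' i : Measure (κ → ℝ)).real (Set.Iic x)) l
      (𝓝 ((ν : Measure (κ → ℝ)).real (Set.Iic x)))) :
    Tendsto ν' l (𝓝 ν) := by
  -- Orthants are unbounded and cannot serve as small neighbourhoods; boxes can, and a π-system
  -- containing arbitrarily small neighbourhoods of each point determines weak convergence.
  let S : Set (Set (κ → ℝ)) :=
    {s | ∃ a b : κ → ℝ, a ≤ b ∧ s = Set.univ.pi fun k => Set.Ioc (a k) (b k)}
  have hS : IsPiSystem S := by
    rintro _ ⟨a, b, hab, rfl⟩ _ ⟨a', b', hab', rfl⟩ ⟨z, hz⟩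
    -- The common point `z` keeps the corners of the intersection in order.
    refine ⟨a ⊔ a', b ⊓ b', fun k => ?_, ?_⟩
    · have h1 := hz.1 k trivial
      have h2 := hz.2 k trivial
      exact ((sup_lt_iff.2 ⟨h1.1, h2.1⟩).le).trans (le_inf h1.2 h2.2)
    · rw [← Set.pi_inter_distrib]
      simp_rw [Set.Ioc_inter_Ioc]
      rfl
  refine hS.tendsto_probabilityMeasure_of_tendsto_of_mem ?_ ?_ ?_
  · rintro _ ⟨a, b, -, rfl⟩
    exact MeasurableSet.univ_pi fun k => measurableSet_Ioc
  · intro u hu x hx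
    obtain ⟨ε, hε, hball⟩ := Metric.isOpen_iff.1 hu x hx
    refine ⟨_, ⟨fun k => x k - ε / 2, fun k => x k + ε / 2, fun k => by simp only; linarith, rfl⟩,
      ?_, ?_⟩
    · exact set_pi_mem_nhds Set.finite_univ fun k _ =>
        Ioc_mem_nhds (by linarith) (by linarith)
    · intro z hz
      refine hball ((dist_pi_lt_iff hε).2 fun k => ?_)
      have hk := hz k trivial
      rw [Real.dist_eq, abs_lt]
      constructor <;> linarith [hk.1, hk.2]
  · rintro _ ⟨a, b, hab, rfl⟩
    have hbox := tendsto_measureReal_box (ν' := fun i => (ν' i : Measure (κ → ℝ)))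
      (ν := (ν : Measure (κ → ℝ))) h hab
    exact NNReal.tendsto_coe.1 hbox

end Orthants

/-! ### Bounded functions converging in probability. -/

section Bounded

/-- Exchange the factors one at a time: the remaining factors are bounded by 1, so each exchange
costs at most `|f k - g k|`. -/
lemma abs_prod_sub_prod_le_sum {κ : Type*} (s : Finset κ) {f g : κ → ℝ}
    (hf : ∀ k ∈ s, |f k| ≤ 1) (hg : ∀ k ∈ s, |g k| ≤ 1) :
    |∏ k ∈ s, f k - ∏ k ∈ s, g k| ≤ ∑ k ∈ s, |f k - g k| := by
  classical
  induction s using Finset.induction_on with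
  | empty => simp
  | insert a s ha ih =>
    rw [Finset.prod_insert ha, Finset.prod_insert ha, Finset.sum_insert ha]
    have ih' := ih (fun k hk => hf k (Finset.mem_insert_of_mem hk))
      (fun k hk => hg k (Finset.mem_insert_of_mem hk))
    have hP : |∏ k ∈ s, f k| ≤ 1 := by
      rw [Finset.abs_prod]
      exact Finset.prod_le_one (fun _ _ => abs_nonneg _)
        fun k hk => hf k (Finset.mem_insert_of_mem hk)
    calc |f a * ∏ k ∈ s, f k - g a * ∏ k ∈ s, g k|
        = |(f a - g a) * ∏ k ∈ s, f k + g a * (∏ k ∈ s, f k - ∏ k ∈ s, g k)| := by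
          congr 1; ring
      _ ≤ |f a - g a| * |∏ k ∈ s, f k| + |g a| * |∏ k ∈ s, f k - ∏ k ∈ s, g k| := by
          rw [← abs_mul, ← abs_mul]; exact abs_add_le _ _
      _ ≤ |f a - g a| * 1 + 1 * ∑ k ∈ s, |f k - g k| := by
          gcongr
          exact hg a (Finset.mem_insert_self _ _)
      _ = _ := by ring

variable {Ω : Type*} [MeasurableSpace Ω] {μ : Measure Ω} [IsProbabilityMeasure μ]

/-- Every subsequence has a further subsequence converging almost everywhere, to which dominated
convergence applies. -/
lemma tendsto_integral_abs_sub_of_tendstoInMeasure {ι : Type*} {l : Filter ι}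
    [l.IsCountablyGenerated] {F : ι → Ω → ℝ} {c : ℝ}
    (hF : ∀ i, AEStronglyMeasurable (F i) μ) (hbd : ∀ i, ∀ᵐ ω ∂μ, |F i ω| ≤ 1)
    (h : TendstoInMeasure μ F l fun _ => c) :
    Tendsto (fun i => ∫ ω, |F i ω - c| ∂μ) l (𝓝 0) := by
  refine tendsto_of_subseq_tendsto fun ns hns => ?_
  obtain ⟨ms, -, hms⟩ := (h.comp hns).exists_seq_tendsto_ae'
  refine ⟨ms, ?_⟩
  rw [← integral_zero Ω ℝ (μ := μ)]
  refine tendsto_integral_of_dominated_convergence (fun _ => 1 + |c|)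
    (fun n => ((hF _).sub aestronglyMeasurable_const).norm) (integrable_const _)
    (fun n => ?_) ?_
  · filter_upwards [hbd (ns (ms n))] with ω hω
    rw [Real.norm_eq_abs, abs_abs]
    exact (abs_sub _ _).trans (by gcongr)
  · filter_upwards [hms] with ω hω
    have := (hω.sub_const c).abs
    simpa using this

end Bounded

/-! ### Conditional independence given the data. -/

section Conditional

variable {Ω α β κ : Type*} [MeasurableSpace Ω] [MeasurableSpace α] [MeasurableSpace β] [Fintype κ]
  {μ : Measure Ω} [IsProbabilityMeasure μ] {Y : Ω → α} {K : κ → Ω → β}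

/-- Fubini for events that are conditionally independent given `Y`. -/
lemma measureReal_inter_eq_setIntegral_prod (hY : Measurable Y) (hK : ∀ b, Measurable (K b))
    (hKind : iIndepFun K μ) (hYK : IndepFun Y (fun ω b => K b ω) μ)
    {A : Set α} (hA : MeasurableSet A) {s : κ → Set (α × β)} (hs : ∀ b, MeasurableSet (s b)) :
    μ.real {ω | Y ω ∈ A ∧ ∀ b, (Y ω, K b ω) ∈ s b} =
      ∫ ω in Y ⁻¹' A, ∏ b, (μ.map (K b)).real (Prod.mk (Y ω) ⁻¹' s b) ∂μ := by
  have hprob : ∀ b, IsProbabilityMeasure (μ.map (K b)) :=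
    fun b => Measure.isProbabilityMeasure_map (hK b).aemeasurable
  have hKm : Measurable fun ω b => K b ω := measurable_pi_lambda _ hK
  let T : Set (α × (κ → β)) := {p | p.1 ∈ A ∧ ∀ b, (p.1, p.2 b) ∈ s b}
  have hT : MeasurableSet T := by
    have : T = Prod.fst ⁻¹' A ∩ ⋂ b, (fun p : α × (κ → β) => (p.1, p.2 b)) ⁻¹' s b := by
      ext p; simp [T]
    rw [this]
    exact (measurable_fst hA).inter (MeasurableSet.iInter fun b =>
      (measurable_fst.prodMk ((measurable_pi_apply b).comp measurable_snd)) (hs b))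
  -- Under this product law, the section of the event at `y ∈ A` is a product set, whose measure
  -- factors over `b`.
  have hlaw : μ.map (fun ω => (Y ω, fun b => K b ω)) =
      (μ.map Y).prod (Measure.pi fun b => μ.map (K b)) := by
    rw [(indepFun_iff_map_prod_eq_prod_map_map hY.aemeasurable hKm.aemeasurable).1 hYK,
      hKind.map_fun_eq_pi_map fun b => (hK b).aemeasurable]
  have hmeas : Measurable fun y => ∏ b, (μ.map (K b)) (Prod.mk y ⁻¹' s b) :=
    Finset.measurable_prod _ fun b _ => measurable_measure_prodMk_left (hs b)
  have hsec : ∀ y, (Measure.pi fun b => μ.map (K b)) (Prod.mk y ⁻¹' T) =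
      A.indicator (fun y => ∏ b, (μ.map (K b)) (Prod.mk y ⁻¹' s b)) y := by
    intro y
    by_cases hy : y ∈ A
    · rw [Set.indicator_of_mem hy, ← Measure.pi_pi]
      congr 1
      ext z
      simp [T, hy]
    · rw [Set.indicator_of_notMem hy]
      have : Prod.mk y ⁻¹' T = ∅ := by ext z; simp [T, hy]
      rw [this, measure_empty]
  have hE : μ {ω | Y ω ∈ A ∧ ∀ b, (Y ω, K b ω) ∈ s b} =
      ∫⁻ ω in Y ⁻¹' A, ∏ b, (μ.map (K b)) (Prod.mk (Y ω) ⁻¹' s b) ∂μ := by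
    change μ ((fun ω => (Y ω, fun b => K b ω)) ⁻¹' T) = _
    rw [← Measure.map_apply (hY.prodMk hKm) hT, hlaw, Measure.prod_apply hT]
    simp_rw [hsec]
    rw [lintegral_indicator hA, setLIntegral_map hA hmeas hY]
  rw [measureReal_def, hE, ← integral_toReal]
  · simp only [ENNReal.toReal_prod, measureReal_def]
  · exact (hmeas.comp hY).aemeasurable
  · exact ae_of_all _ fun ω => ENNReal.prod_lt_top fun b _ => measure_lt_top _ _

/-- The conditional probability of an event determined by `Y` and an independent variable. -/
lemma condExp_indicator_ae_eq_of_indepFun {V : Ω → β} (hY : Measurable Y) (hV : Measurable V)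
    (hYV : IndepFun Y V μ) {s : Set (α × β)} (hs : MeasurableSet s) :
    μ⟦{ω | (Y ω, V ω) ∈ s} | MeasurableSpace.comap Y inferInstance⟧ =ᵐ[μ]
      fun ω => (μ.map V).real (Prod.mk (Y ω) ⁻¹' s) := by
  have hprob : IsProbabilityMeasure (μ.map V) := Measure.isProbabilityMeasure_map hV.aemeasurable
  have hm : Measurable fun y => (μ.map V).real (Prod.mk y ⁻¹' s) :=
    (measurable_measure_prodMk_left hs).ennreal_toReal
  have hset : MeasurableSet {ω | (Y ω, V ω) ∈ s} := (hY.prodMk hV) hs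
  have hint : Integrable (fun ω => (μ.map V).real (Prod.mk (Y ω) ⁻¹' s)) μ :=
    Integrable.of_bound (hm.comp hY).aestronglyMeasurable 1
      (ae_of_all _ fun ω => by
        rw [Real.norm_eq_abs, abs_of_nonneg measureReal_nonneg]; exact measureReal_le_one)
  refine (ae_eq_condExp_of_forall_setIntegral_eq hY.comap_le
    ((integrable_const (1 : ℝ)).indicator hset) (fun _ _ _ => hint.integrableOn) ?_ ?_).symm
  · rintro _ ⟨A, hA, rfl⟩ -
    -- For a one-element family the Fubini identity is the defining property of the conditional
    -- expectation.
    have hind : iIndepFun (fun _ : Unit => V) μ := iIndepFun.of_subsingleton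
    have hpair : IndepFun Y (fun ω (_ : Unit) => V ω) μ :=
      hYV.comp measurable_id (measurable_pi_lambda (fun v (_ : Unit) => v) fun _ => measurable_id)
    have key := measureReal_inter_eq_setIntegral_prod hY (fun _ : Unit => hV) hind hpair hA
      (s := fun _ => s) fun _ => hs
    simp only [Finset.univ_unique, Finset.prod_singleton] at key
    rw [← key, setIntegral_indicator hset, setIntegral_const, smul_eq_mul, mul_one]
    congr 1
    ext ω
    simp
  · exact (hm.comp (comap_measurable Y)).aestronglyMeasurable

/-- Replaces the section measures by conditional probabilities, the form in which bootstrap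
consistency is assumed. -/
lemma measureReal_inter_eq_setIntegral_prod_condExp (hY : Measurable Y)
    (hK : ∀ b, Measurable (K b)) (hKind : iIndepFun K μ)
    (hYK : IndepFun Y (fun ω b => K b ω) μ)
    {A : Set α} (hA : MeasurableSet A) {s : κ → Set (α × β)} (hs : ∀ b, MeasurableSet (s b)) :
    μ.real {ω | Y ω ∈ A ∧ ∀ b, (Y ω, K b ω) ∈ s b} =
      ∫ ω in Y ⁻¹' A, ∏ b,
        (μ⟦{ω | (Y ω, K b ω) ∈ s b} | MeasurableSpace.comap Y inferInstance⟧) ω ∂μ := by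
  rw [measureReal_inter_eq_setIntegral_prod hY hK hKind hYK hA hs]
  refine integral_congr_ae (ae_restrict_of_ae ?_)
  have hall : ∀ᵐ ω ∂μ, ∀ b,
      (μ⟦{ω | (Y ω, K b ω) ∈ s b} | MeasurableSpace.comap Y inferInstance⟧) ω =
        (μ.map (K b)).real (Prod.mk (Y ω) ⁻¹' s b) :=
    ae_all_iff.2 fun b => condExp_indicator_ae_eq_of_indepFun hY (hK b)
      (hYK.comp measurable_id (measurable_pi_apply b)) (hs b)
  filter_upwards [hall] with ω hω
  exact Finset.prod_congr rfl fun b _ => (hω b).symm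

/-- Replacing the product by its limit costs at most `∑ b, ∫ |F b i - c b|`, whatever the set of
integration. Hence the sets `A i` may vary with `i` and depend on the `F b i`. -/
lemma tendsto_setIntegral_prod {ι : Type*} {l : Filter ι} [l.IsCountablyGenerated]
    {A : ι → Set Ω} {a : ℝ}
    (hlim : Tendsto (fun i => μ.real (A i)) l (𝓝 a)) {F : κ → ι → Ω → ℝ} {c : κ → ℝ}
    (hF : ∀ b i, AEStronglyMeasurable (F b i) μ) (hbd : ∀ b i, ∀ᵐ ω ∂μ, |F b i ω| ≤ 1)
    (hc : ∀ b, |c b| ≤ 1) (h : ∀ b, TendstoInMeasure μ (F b) l fun _ => c b) :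
    Tendsto (fun i => ∫ ω in A i, ∏ b, F b i ω ∂μ) l (𝓝 (a * ∏ b, c b)) := by
  have hsum : Tendsto (fun i => ∑ b, ∫ ω, |F b i ω - c b| ∂μ) l (𝓝 0) := by
    rw [← Finset.sum_const_zero (ι := κ) (s := Finset.univ)]
    exact tendsto_finsetSum _ fun b _ =>
      tendsto_integral_abs_sub_of_tendstoInMeasure (hF b) (hbd b) (h b)
  have hintF : ∀ b i, Integrable (fun ω => |F b i ω - c b|) μ := fun b i =>
    ((Integrable.of_bound (hF b i) 1 (hbd b i)).sub (integrable_const _)).abs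
  have hintP : ∀ i, Integrable (fun ω => ∏ b, F b i ω) μ := by
    intro i
    refine Integrable.of_bound (Finset.aestronglyMeasurable_fun_prod _ fun b _ => hF b i) 1 ?_
    filter_upwards [ae_all_iff.2 fun b => hbd b i] with ω hω
    rw [Real.norm_eq_abs, Finset.abs_prod]
    exact Finset.prod_le_one (fun _ _ => abs_nonneg _) fun b _ => hω b
  have hdiff : Tendsto (fun i => ∫ ω in A i, ∏ b, F b i ω ∂μ - μ.real (A i) * ∏ b, c b) l
      (𝓝 0) := by
    refine squeeze_zero_norm (fun i => ?_) hsum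
    have hconst : μ.real (A i) * ∏ b, c b = ∫ _ in A i, ∏ b, c b ∂μ := by
      rw [setIntegral_const, smul_eq_mul]
    rw [hconst, ← integral_sub (hintP i).integrableOn (integrable_const _)]
    calc ‖∫ ω in A i, (∏ b, F b i ω - ∏ b, c b) ∂μ‖
        ≤ ∫ ω in A i, |∏ b, F b i ω - ∏ b, c b| ∂μ := norm_integral_le_integral_norm _
      _ ≤ ∫ ω, |∏ b, F b i ω - ∏ b, c b| ∂μ :=
          setIntegral_le_integral ((hintP i).sub (integrable_const _)).abs
            (ae_of_all _ fun _ => abs_nonneg _)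
      _ ≤ ∫ ω, ∑ b, |F b i ω - c b| ∂μ := by
          refine integral_mono_ae ((hintP i).sub (integrable_const _)).abs
            (integrable_finsetSum _ fun b _ => hintF b i) ?_
          filter_upwards [ae_all_iff.2 fun b => hbd b i] with ω hω
          exact abs_prod_sub_prod_le_sum _ (fun b _ => hω b) fun b _ => hc b
      _ = _ := integral_finsetSum _ fun b _ => hintF b i
  simpa using hdiff.add (hlim.mul_const (∏ b, c b))

end Conditional

/-! ### Linear invariance and regularity of the statistic. -/

section Algebra

variable {d B : ℕ}

lemma secondMoment_mulVec (A : Matrix (Fin d) (Fin d) ℝ)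
    (v : Fin B → EuclideanSpace ℝ (Fin d)) :
    secondMoment (fun b => WithLp.toLp 2 (A *ᵥ (v b).ofLp)) = A * secondMoment v * Aᵀ := by
  simp only [secondMoment, Matrix.mul_smul, Matrix.smul_mul, Matrix.mul_sum, Matrix.sum_mul,
    Matrix.mul_vecMulVec, Matrix.vecMulVec_mul, Matrix.vecMul_transpose]

lemma isUnit_det_secondMoment_mulVec {A : Matrix (Fin d) (Fin d) ℝ} (hA : IsUnit A.det)
    (v : Fin B → EuclideanSpace ℝ (Fin d)) :
    IsUnit (secondMoment fun b => WithLp.toLp 2 (A *ᵥ (v b).ofLp)).det ↔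
      IsUnit (secondMoment v).det := by
  simp only [secondMoment_mulVec, Matrix.det_mul, Matrix.det_transpose, IsUnit.mul_iff, hA,
    true_and, and_true]

/-- The factors `A` cancel in `(A u)ᵀ (A M Aᵀ)⁻¹ (A u)`. A singular `M` needs no separate case,
since the inverse, read as 0 there, still reverses products. Used with a scalar matrix to drop `√n`,
and with a square root of the covariance to standardize the limit. -/
lemma invForm_secondMoment_mulVec {A : Matrix (Fin d) (Fin d) ℝ} (hA : IsUnit A.det)
    (v : Fin B → EuclideanSpace ℝ (Fin d)) (u : EuclideanSpace ℝ (Fin d)) :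
    invForm (secondMoment fun b => WithLp.toLp 2 (A *ᵥ (v b).ofLp))
      (WithLp.toLp 2 (A *ᵥ u.ofLp)) = invForm (secondMoment v) u := by
  have hAt : IsUnit Aᵀ.det := by rwa [Matrix.det_transpose]
  rw [secondMoment_mulVec, invForm, invForm, Matrix.mul_inv_rev, Matrix.mul_inv_rev]
  simp only [Matrix.mulVec_mulVec, mul_assoc, Matrix.nonsing_inv_mul _ hA, mul_one]
  rw [← Matrix.vecMul_transpose, ← Matrix.dotProduct_mulVec, Matrix.mulVec_mulVec, ← mul_assoc,
    Matrix.mul_nonsing_inv _ hAt, one_mul]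

lemma isUnit_det_smul_one {c : ℝ} (hc : c ≠ 0) :
    IsUnit (c • (1 : Matrix (Fin d) (Fin d) ℝ)).det := by
  simp [hc]

lemma isUnit_det_secondMoment_smul {c : ℝ} (hc : c ≠ 0)
    (v : Fin B → EuclideanSpace ℝ (Fin d)) :
    IsUnit (secondMoment fun b => c • v b).det ↔ IsUnit (secondMoment v).det := by
  rw [← isUnit_det_secondMoment_mulVec (isUnit_det_smul_one hc) v]
  simp only [Matrix.smul_mulVec, Matrix.one_mulVec, WithLp.toLp_smul, WithLp.toLp_ofLp]

lemma invForm_secondMoment_smul {c : ℝ} (hc : c ≠ 0)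
    (v : Fin B → EuclideanSpace ℝ (Fin d)) (u : EuclideanSpace ℝ (Fin d)) :
    invForm (secondMoment fun b => c • v b) (c • u) = invForm (secondMoment v) u := by
  rw [← invForm_secondMoment_mulVec (isUnit_det_smul_one hc) v u]
  simp only [Matrix.smul_mulVec, Matrix.one_mulVec, WithLp.toLp_smul, WithLp.toLp_ofLp]

/-- Cramer's rule: a quotient of polynomials in the entries, hence measurable everywhere and
continuous off the zero set of the determinant. For singular `M` both sides are 0. -/
lemma invForm_eq_div (M : Matrix (Fin d) (Fin d) ℝ) (u : EuclideanSpace ℝ (Fin d)) :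
    invForm M u = (u.ofLp ⬝ᵥ (M.adjugate *ᵥ u.ofLp)) / M.det := by
  rw [invForm, Matrix.inv_def, Ring.inverse_eq_inv', Matrix.smul_mulVec, dotProduct_smul,
    smul_eq_mul, div_eq_inv_mul]

lemma continuous_secondMoment :
    Continuous (secondMoment : (Fin B → EuclideanSpace ℝ (Fin d)) → Matrix (Fin d) (Fin d) ℝ) := by
  unfold secondMoment
  have h : ∀ b, Continuous fun v : Fin B → EuclideanSpace ℝ (Fin d) =>
      Matrix.vecMulVec (v b).ofLp (v b).ofLp := fun b => by
    have hb : Continuous fun v : Fin B → EuclideanSpace ℝ (Fin d) => (v b).ofLp := by fun_prop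
    exact hb.matrix_vecMulVec hb
  exact (continuous_finsetSum Finset.univ fun b _ => h b).const_smul ((B : ℝ)⁻¹)

lemma continuous_det_secondMoment :
    Continuous fun p : EuclideanSpace ℝ (Fin d) × (Fin B → EuclideanSpace ℝ (Fin d)) =>
      (secondMoment p.2).det :=
  (continuous_secondMoment.comp continuous_snd).matrix_det

lemma continuous_adjugate_form :
    Continuous fun p : EuclideanSpace ℝ (Fin d) × (Fin B → EuclideanSpace ℝ (Fin d)) =>
      p.1.ofLp ⬝ᵥ ((secondMoment p.2).adjugate *ᵥ p.1.ofLp) := by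
  have h1 : Continuous fun p : EuclideanSpace ℝ (Fin d) × (Fin B → EuclideanSpace ℝ (Fin d)) =>
    p.1.ofLp := by fun_prop
  exact h1.dotProduct
    (((continuous_secondMoment.comp continuous_snd).matrix_adjugate).matrix_mulVec h1)

lemma measurable_invForm_secondMoment :
    Measurable fun p : EuclideanSpace ℝ (Fin d) × (Fin B → EuclideanSpace ℝ (Fin d)) =>
      invForm (secondMoment p.2) p.1 := by
  simp_rw [invForm_eq_div]
  exact continuous_adjugate_form.measurable.div continuous_det_secondMoment.measurable

lemma continuousAt_invForm_secondMoment
    {p : EuclideanSpace ℝ (Fin d) × (Fin B → EuclideanSpace ℝ (Fin d))}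
    (hp : (secondMoment p.2).det ≠ 0) :
    ContinuousAt (fun p : EuclideanSpace ℝ (Fin d) × (Fin B → EuclideanSpace ℝ (Fin d)) =>
      invForm (secondMoment p.2) p.1) p := by
  simp_rw [invForm_eq_div]
  exact continuous_adjugate_form.continuousAt.div continuous_det_secondMoment.continuousAt hp

/-- Where the determinant is nonzero the statistic is continuous, so either strict inequality with
`q` persists nearby and excludes a frontier point. -/
lemma frontier_invForm_le_subset (q : ℝ) :
    frontier {p : EuclideanSpace ℝ (Fin d) × (Fin B → EuclideanSpace ℝ (Fin d)) |
        invForm (secondMoment p.2) p.1 ≤ q} ⊆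
      {p | ¬ IsUnit (secondMoment p.2).det} ∪ {p | invForm (secondMoment p.2) p.1 = q} := by
  intro p hp
  by_contra hcon
  simp only [Set.mem_union, Set.mem_ofPred_eq, not_or, not_not] at hcon
  obtain ⟨hdet, hq⟩ := hcon
  have hcont := continuousAt_invForm_secondMoment hdet.ne_zero
  rcases lt_or_gt_of_ne hq with hlt | hgt
  · exact hp.2 (mem_interior_iff_mem_nhds.2
      ((hcont.eventually_lt continuousAt_const hlt).mono fun _ h => h.le))
  · obtain ⟨z, hz1, hz2⟩ := mem_closure_iff_nhds.1 hp.1 _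
      (continuousAt_const.eventually_lt hcont hgt)
    exact absurd (show invForm (secondMoment z.2) z.1 ≤ q from hz2) (not_le.2 hz1)

/-- The quadratic form at `x` is the mean of the squares `⟨v b, x⟩²`. If it vanishes, `x` is
orthogonal to the span of the `v b`, hence to itself. -/
lemma secondMoment_posDef (hB : 0 < B) {v : Fin B → EuclideanSpace ℝ (Fin d)}
    (hv : Submodule.span ℝ (Set.range v) = ⊤) : (secondMoment v).PosDef := by
  have hform : ∀ x : Fin d → ℝ, x ⬝ᵥ (secondMoment v *ᵥ x) =
      (B : ℝ)⁻¹ * ∑ b, ((v b).ofLp ⬝ᵥ x) ^ 2 := by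
    intro x
    rw [secondMoment, Matrix.smul_mulVec, dotProduct_smul, smul_eq_mul, Matrix.sum_mulVec,
      dotProduct_sum]
    congr 1
    refine Finset.sum_congr rfl fun b _ => ?_
    rw [Matrix.vecMulVec_mulVec, op_smul_eq_smul, dotProduct_smul, smul_eq_mul, dotProduct_comm x,
      sq]
  have hB' : (0 : ℝ) < (B : ℝ)⁻¹ := by positivity
  refine Matrix.PosDef.of_dotProduct_mulVec_pos ?_ fun x hx => ?_
  · rw [Matrix.IsHermitian, Matrix.conjTranspose_eq_transpose_of_trivial, secondMoment,
      Matrix.transpose_smul, Matrix.transpose_sum]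
    simp only [Matrix.transpose_vecMulVec]
  · rw [star_trivial, hform]
    refine mul_pos hB' (lt_of_le_of_ne (Finset.sum_nonneg fun b _ => sq_nonneg _) fun h0 => hx ?_)
    have hz : ∀ b, (v b).ofLp ⬝ᵥ x = 0 := fun b => by
      simpa using (Finset.sum_eq_zero_iff_of_nonneg fun b _ => sq_nonneg _).1 h0.symm b
        (Finset.mem_univ b)
    have hperp : ∀ y ∈ Submodule.span ℝ (Set.range v), y.ofLp ⬝ᵥ x = 0 := by
      intro y hy
      induction hy using Submodule.span_induction with
      | mem y hy => obtain ⟨b, rfl⟩ := hy; exact hz b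
      | zero => simp
      | add y z _ _ h1 h2 => simp [add_dotProduct, h1, h2]
      | smul c y _ h => simp [smul_dotProduct, h]
    exact dotProduct_self_eq_zero.1 (hperp (WithLp.toLp 2 x) (hv ▸ Submodule.mem_top))

end Algebra

/-! ### Random vectors spanning the space. -/

section Span

variable {E : Type*} [NormedAddCommGroup E] [NormedSpace ℝ E] [FiniteDimensional ℝ E]
  [MeasurableSpace E] [BorelSpace E]

/-- Independent samples from a distribution that does not charge proper subspaces are almost
surely linearly independent, up to the point where they span the space. -/
lemma ae_linearIndependent_or_span_eq_top {ν : Measure E} [IsProbabilityMeasure ν]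
    (hν : ∀ W : Submodule ℝ E, W ≠ ⊤ → ν W = 0) (k : ℕ) :
    ∀ᵐ v ∂Measure.pi fun _ : Fin k => ν,
      LinearIndependent ℝ v ∨ Submodule.span ℝ (Set.range v) = ⊤ := by
  induction k with
  | zero => exact ae_of_all _ fun v => Or.inl linearIndependent_empty_type
  | succ k ih =>
    have hmp := measurePreserving_piFinSuccAbove (fun _ : Fin (k + 1) => ν) 0
    have h1 : ∀ᵐ p ∂ν.prod (Measure.pi fun _ : Fin k => ν),
        LinearIndependent ℝ p.2 ∨ Submodule.span ℝ (Set.range p.2) = ⊤ :=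
      Measure.quasiMeasurePreserving_snd.ae ih
    have hcons : Measurable fun p : E × (Fin k → E) => (Fin.cons p.1 p.2 : Fin (k + 1) → E) := by
      refine measurable_pi_lambda _ fun i => ?_
      refine Fin.cases ?_ (fun j => ?_) i
      · simpa using measurable_fst
      · exact (measurable_pi_apply j).comp measurable_snd
    have h2 : ∀ᵐ p ∂ν.prod (Measure.pi fun _ : Fin k => ν),
        LinearIndependent ℝ p.2 → Submodule.span ℝ (Set.range p.2) ≠ ⊤ →
          LinearIndependent ℝ (Fin.cons p.1 p.2 : Fin (k + 1) → E) := by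
      -- With `k` equal to the dimension, independent vectors already span. Otherwise they span a
      -- proper subspace, which the new vector almost surely avoids. Dropping the spanning premise
      -- in the second case leaves a set described by linear independence alone, an open condition,
      -- so measurability is immediate.
      by_cases hk : k = Module.finrank ℝ E
      · refine ae_of_all _ fun p hp hs => absurd ?_ hs
        exact hp.span_eq_top_of_card_eq_finrank' (by simpa using hk)
      · have hmeas : MeasurableSet {p : E × (Fin k → E) | LinearIndependent ℝ p.2 →
            LinearIndependent ℝ (Fin.cons p.1 p.2 : Fin (k + 1) → E)} := by
          have hset : ∀ n, MeasurableSet {v : Fin n → E | LinearIndependent ℝ v} :=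
            fun n => isOpen_setOfPred_linearIndependent.measurableSet
          exact MeasurableSet.imp (measurable_snd (hset k)) (hcons (hset (k + 1)))
        have h3 : ∀ᵐ p ∂ν.prod (Measure.pi fun _ : Fin k => ν),
            LinearIndependent ℝ p.2 →
              LinearIndependent ℝ (Fin.cons p.1 p.2 : Fin (k + 1) → E) := by
          rw [Measure.ae_prod_iff_ae_ae hmeas, Measure.ae_ae_comm hmeas]
          refine ae_of_all _ fun v => ?_
          by_cases hv : LinearIndependent ℝ v
          · have hspan : Submodule.span ℝ (Set.range v) ≠ ⊤ := fun h => hk (by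
              rw [← finrank_top ℝ E, ← h, finrank_span_eq_card hv, Fintype.card_fin])
            filter_upwards [measure_eq_zero_iff_ae_notMem.1 (hν _ hspan)] with x hx
            exact fun _ => linearIndependent_finCons.2 ⟨hv, hx⟩
          · exact ae_of_all _ fun x h => absurd h hv
        filter_upwards [h3] with p hp h _ using hp h
    have h4 : ∀ᵐ p ∂ν.prod (Measure.pi fun _ : Fin k => ν),
        LinearIndependent ℝ (Fin.cons p.1 p.2 : Fin (k + 1) → E) ∨
          Submodule.span ℝ (Set.range (Fin.cons p.1 p.2 : Fin (k + 1) → E)) = ⊤ := by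
      filter_upwards [h1, h2] with p hp1 hp2
      by_cases hs : Submodule.span ℝ (Set.range p.2) = ⊤
      · refine Or.inr (top_unique (hs.symm.le.trans (Submodule.span_mono ?_)))
        rw [Fin.range_cons]
        exact Set.subset_insert _ _
      · exact Or.inl (hp2 (hp1.resolve_right hs) hs)
    filter_upwards [hmp.quasiMeasurePreserving.ae h4] with v hv
    have hv' : (Fin.cons (v 0) (fun j : Fin k => v j.succ) : Fin (k + 1) → E) = v :=
      Fin.cons_self_tail v
    change LinearIndependent ℝ (Fin.cons (v 0) (fun j : Fin k => v j.succ) : Fin (k + 1) → E) ∨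
      Submodule.span ℝ (Set.range
        (Fin.cons (v 0) (fun j : Fin k => v j.succ) : Fin (k + 1) → E)) = ⊤ at hv
    rwa [hv'] at hv

lemma ae_span_eq_top {ν : Measure E} [IsProbabilityMeasure ν]
    (hν : ∀ W : Submodule ℝ E, W ≠ ⊤ → ν W = 0) {k : ℕ} (hk : Module.finrank ℝ E ≤ k) :
    ∀ᵐ v ∂Measure.pi fun _ : Fin k => ν, Submodule.span ℝ (Set.range v) = ⊤ := by
  filter_upwards [ae_linearIndependent_or_span_eq_top hν k] with v hv
  refine hv.elim (fun h => h.span_eq_top_of_card_eq_finrank' ?_) id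
  -- Independence bounds `k` by the dimension, so the two agree.
  exact le_antisymm h.fintype_card_le_finrank (by simpa using hk)

end Span

/-! ### Null sets of Gaussian vectors and absence of atoms in Hotelling's law. -/

section Gaussian

/-- The inner product with `w` is a real Gaussian of variance `‖w‖² > 0`, which has no atoms. -/
lemma stdGaussian_hyperplane {E : Type*} [NormedAddCommGroup E] [InnerProductSpace ℝ E]
    [FiniteDimensional ℝ E] [MeasurableSpace E] [BorelSpace E] {w : E} (hw : w ≠ 0) (c : ℝ) :
    stdGaussian E {z | inner ℝ w z = c} = 0 := by
  have hmap := IsGaussian.map_eq_gaussianReal (μ := stdGaussian E) (innerSL ℝ w)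
  have hvar : (Var[innerSL ℝ w; stdGaussian E]).toNNReal ≠ 0 := by
    rw [variance_dual_stdGaussian, innerSL_apply_norm]
    exact (Real.toNNReal_pos.2 (by positivity)).ne'
  have := nullSingletonClass_gaussianReal (μ := (stdGaussian E)[innerSL ℝ w]) hvar
  have h0 : ((stdGaussian E).map (innerSL ℝ w)) {c} = 0 := by
    rw [hmap]; exact measure_singleton c
  rwa [Measure.map_apply (by fun_prop) (measurableSet_singleton c)] at h0

lemma stdGaussian_submodule {E : Type*} [NormedAddCommGroup E] [InnerProductSpace ℝ E]
    [FiniteDimensional ℝ E] [MeasurableSpace E] [BorelSpace E] (W : Submodule ℝ E) (hW : W ≠ ⊤) :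
    stdGaussian E W = 0 := by
  obtain ⟨w, hw, hw0⟩ := Submodule.exists_mem_ne_zero_of_ne_bot
    (mt Submodule.orthogonal_eq_bot_iff.1 hW)
  exact measure_mono_null (fun z hz => Submodule.inner_left_of_mem_orthogonal hz hw)
    (stdGaussian_hyperplane hw0 0)

variable {d B : ℕ}

lemma ae_secondMoment_posDef (hd : 1 ≤ d) (hB : d ≤ B) :
    ∀ᵐ v ∂Measure.pi fun _ : Fin B => stdGaussian (EuclideanSpace ℝ (Fin d)),
      (secondMoment v).PosDef := by
  filter_upwards [ae_span_eq_top stdGaussian_submodule (k := B) (by simpa using hB)] with v hv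
  exact secondMoment_posDef (by omega) hv

/-- Fubini in the first coordinate: an atomless measure gives countable sections mass 0. -/
lemma pi_null_of_countable_sections {n : ℕ} {γ : Measure ℝ} [IsProbabilityMeasure γ] [NullSingletonClass γ]
    {s : Set (Fin (n + 1) → ℝ)} (hs : MeasurableSet s)
    (h : ∀ z : Fin n → ℝ, {t : ℝ | (Fin.cons t z : Fin (n + 1) → ℝ) ∈ s}.Countable) :
    (Measure.pi fun _ : Fin (n + 1) => γ) s = 0 := by
  have hmp := measurePreserving_piFinSuccAbove (fun _ : Fin (n + 1) => γ) 0
  have hcons : Measurable fun p : ℝ × (Fin n → ℝ) => (Fin.cons p.1 p.2 : Fin (n + 1) → ℝ) := by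
    refine measurable_pi_lambda _ fun i => ?_
    refine Fin.cases ?_ (fun j => ?_) i
    · simpa using measurable_fst
    · exact (measurable_pi_apply j).comp measurable_snd
  have hmeas : MeasurableSet {p : ℝ × (Fin n → ℝ) | (Fin.cons p.1 p.2 : Fin (n + 1) → ℝ) ∉ s} :=
    hcons hs.compl
  have hae : ∀ᵐ p ∂γ.prod (Measure.pi fun _ : Fin n => γ),
      (Fin.cons p.1 p.2 : Fin (n + 1) → ℝ) ∉ s := by
    rw [Measure.ae_prod_iff_ae_ae hmeas, Measure.ae_ae_comm hmeas]
    exact ae_of_all _ fun z => measure_eq_zero_iff_ae_notMem.1 ((h z).measure_zero γ)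
  rw [measure_eq_zero_iff_ae_notMem]
  filter_upwards [hmp.quasiMeasurePreserving.ae hae] with v hv
  have hv' : (Fin.cons (v 0) (fun j : Fin n => v j.succ) : Fin (n + 1) → ℝ) = v :=
    Fin.cons_self_tail v
  change (Fin.cons (v 0) (fun j : Fin n => v j.succ) : Fin (n + 1) → ℝ) ∉ s at hv
  rwa [hv'] at hv

lemma finite_setOf_quadratic_eq {a : ℝ} (ha : a ≠ 0) (b c : ℝ) :
    {t : ℝ | a * t ^ 2 + b * t = c}.Finite := by
  by_cases h : ∃ t₀ : ℝ, a * t₀ ^ 2 + b * t₀ = c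
  · obtain ⟨t₀, h₀⟩ := h
    -- By Vieta the two roots sum to `-b / a`.
    refine (Set.toFinite {t₀, -b / a - t₀}).subset fun t ht => ?_
    have ht' : a * t ^ 2 + b * t = c := ht
    have hprod : (t - t₀) * (a * (t + t₀) + b) = 0 := by linear_combination ht' - h₀
    rcases mul_eq_zero.1 hprod with h1 | h1
    · exact Or.inl (sub_eq_zero.1 h1)
    · refine Or.inr ?_
      rw [Set.mem_singleton_iff]
      field_simp
      linarith
  · push Not at h
    convert Set.finite_empty
    exact Set.eq_empty_of_forall_notMem fun t => h t

/-- On each line parallel to the first axis `e` the form is a quadratic polynomial with leading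
coefficient `e ⬝ᵥ A e > 0`, so the line meets the level set in finitely many points. The bound `1 ≤
d` provides this axis. -/
lemma stdGaussian_quadric (hd : 1 ≤ d) {A : Matrix (Fin d) (Fin d) ℝ} (hA : A.PosDef) (c : ℝ) :
    stdGaussian (EuclideanSpace ℝ (Fin d)) {u | u.ofLp ⬝ᵥ (A *ᵥ u.ofLp) = c} = 0 := by
  obtain ⟨n, rfl⟩ : ∃ n, d = n + 1 := ⟨d - 1, by omega⟩
  have hcont : Continuous fun x : Fin (n + 1) → ℝ => x ⬝ᵥ (A *ᵥ x) :=
    continuous_id.dotProduct (continuous_const.matrix_mulVec continuous_id)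
  have hs : MeasurableSet {x : Fin (n + 1) → ℝ | x ⬝ᵥ (A *ᵥ x) = c} :=
    hcont.measurable (measurableSet_singleton c)
  have hs' : MeasurableSet {u : EuclideanSpace ℝ (Fin (n + 1)) | u.ofLp ⬝ᵥ (A *ᵥ u.ofLp) = c} :=
    (by fun_prop : Measurable fun u : EuclideanSpace ℝ (Fin (n + 1)) => u.ofLp) hs
  have := nullSingletonClass_gaussianReal (μ := 0) (v := 1) one_ne_zero
  rw [← map_pi_eq_stdGaussian, Measure.map_apply (by fun_prop) hs']
  refine pi_null_of_countable_sections hs fun z => Set.Finite.countable ?_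
  let e : Fin (n + 1) → ℝ := Pi.single 0 1
  let w : Fin (n + 1) → ℝ := Fin.cons 0 z
  have he : e ≠ 0 := by simp [e]
  have hpos : 0 < e ⬝ᵥ (A *ᵥ e) := by simpa using hA.dotProduct_mulVec_pos he
  have hdecomp : ∀ t : ℝ, (Fin.cons t z : Fin (n + 1) → ℝ) = t • e + w := by
    intro t
    ext i
    refine Fin.cases ?_ (fun j => ?_) i <;> simp [e, w]
  refine (finite_setOf_quadratic_eq hpos.ne' (e ⬝ᵥ (A *ᵥ w) + w ⬝ᵥ (A *ᵥ e))
    (c - w ⬝ᵥ (A *ᵥ w))).subset fun t ht => ?_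
  have ht' : (Fin.cons t z : Fin (n + 1) → ℝ) ⬝ᵥ (A *ᵥ Fin.cons t z) = c := ht
  rw [hdecomp, Matrix.mulVec_add, Matrix.mulVec_smul, add_dotProduct, dotProduct_add,
    dotProduct_add, smul_dotProduct, smul_dotProduct, dotProduct_smul, dotProduct_smul] at ht'
  simp only [smul_eq_mul] at ht'
  change _ = _
  linear_combination ht'

/-- With the second component fixed, its second-moment matrix is almost surely positive definite,
and so is the inverse; the first component then has to avoid a quadric. -/
lemma ae_invForm_ne (hd : 1 ≤ d) (hB : d ≤ B) (c : ℝ) :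
    ∀ᵐ p ∂(stdGaussian (EuclideanSpace ℝ (Fin d))).prod
      (Measure.pi fun _ : Fin B => stdGaussian (EuclideanSpace ℝ (Fin d))),
      invForm (secondMoment p.2) p.1 ≠ c := by
  have hmeas : MeasurableSet
      {p : EuclideanSpace ℝ (Fin d) × (Fin B → EuclideanSpace ℝ (Fin d)) |
        invForm (secondMoment p.2) p.1 ≠ c} :=
    measurable_invForm_secondMoment (measurableSet_singleton c).compl
  rw [Measure.ae_prod_iff_ae_ae hmeas, Measure.ae_ae_comm hmeas]
  filter_upwards [ae_secondMoment_posDef hd hB] with v hv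
  exact measure_eq_zero_iff_ae_notMem.1 (stdGaussian_quadric hd hv.inv c)

instance isProbabilityMeasure_hotelling (d B : ℕ) : IsProbabilityMeasure (hotelling d B) :=
  Measure.isProbabilityMeasure_map measurable_invForm_secondMoment.aemeasurable

lemma nullSingletonClass_hotelling (hd : 1 ≤ d) (hB : d ≤ B) : NullSingletonClass (hotelling d B) := by
  refine ⟨fun c => ?_⟩
  rw [hotelling, Measure.map_apply measurable_invForm_secondMoment (measurableSet_singleton c)]
  exact measure_eq_zero_iff_ae_notMem.2 (ae_invForm_ne hd hB c)

end Gaussian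

/-! ### Quantiles of atomless laws. -/

section Quantile

/-- The jump of the distribution function at `x` is the mass of `{x}`. -/
lemma continuous_cdf (ρ : Measure ℝ) [IsProbabilityMeasure ρ] [NullSingletonClass ρ] :
    Continuous (cdf ρ) := by
  refine continuous_iff_continuousAt.2 fun x => ?_
  rw [(cdf ρ).mono.continuousAt_iff_leftLim_eq_rightLim, StieltjesFunction.rightLim_eq]
  have h := (cdf ρ).measure_singleton x
  rw [measure_cdf, measure_singleton, eq_comm, ENNReal.ofReal_eq_zero] at h
  exact le_antisymm ((cdf ρ).mono.leftLim_le le_rfl) (by linarith)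

/-- By continuity the value `p` is attained, and the superlevel set is closed, so its infimum
belongs to it and lies below any point where `p` is attained. -/
lemma measureReal_Iic_quantile (ρ : Measure ℝ) [IsProbabilityMeasure ρ] [NullSingletonClass ρ] {p : ℝ}
    (hp0 : 0 < p) (hp1 : p < 1) : ρ.real (Set.Iic (quantile ρ p)) = p := by
  have hset : {x : ℝ | p ≤ ρ.real (Set.Iic x)} = {x | p ≤ cdf ρ x} := by
    simp_rw [cdf_eq_real]
  rw [quantile, hset, ← cdf_eq_real]
  obtain ⟨a, ha⟩ := ((tendsto_cdf_atBot ρ).eventually_lt_const hp0).exists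
  obtain ⟨b, hb⟩ := ((tendsto_cdf_atTop ρ).eventually_const_lt hp1).exists
  obtain ⟨x, hx⟩ : p ∈ Set.range (cdf ρ) :=
    mem_range_of_exists_le_of_exists_ge (continuous_cdf ρ) ⟨a, ha.le⟩ ⟨b, hb.le⟩
  have hbdd : BddBelow {x | p ≤ cdf ρ x} := by
    refine ⟨a, fun y hy => ?_⟩
    by_contra hlt
    exact absurd (hy.trans ((cdf ρ).mono (not_le.1 hlt).le)) (not_le.2 ha)
  have hmem : sInf {x | p ≤ cdf ρ x} ∈ {x | p ≤ cdf ρ x} :=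
    (isClosed_le continuous_const (continuous_cdf ρ)).csInf_mem ⟨x, hx.ge⟩ hbdd
  exact le_antisymm (((cdf ρ).mono (csInf_le hbdd hx.ge)).trans hx.le) hmem

end Quantile

/-! ### Independence of the rows of an array. -/

section Independence

/-- Rows of an independent array are independent. -/
lemma iIndepFun_curry {Ω ι κ 𝓧 : Type*} [MeasurableSpace Ω] [MeasurableSpace 𝓧] [Countable ι]
    [Countable κ] {μ : Measure Ω} [IsProbabilityMeasure μ] {X : ι × κ → Ω → 𝓧}
    (hX : ∀ p, Measurable (X p)) (h : iIndepFun X μ) :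
    iIndepFun (fun i ω j => X (i, j) ω) μ := by
  have hprob : ∀ p, IsProbabilityMeasure (μ.map (X p)) :=
    fun p => Measure.isProbabilityMeasure_map (hX p).aemeasurable
  have hrow : ∀ i, μ.map (fun ω j => X (i, j) ω) =
      Measure.infinitePi fun j => μ.map (X (i, j)) := fun i =>
    (h.precomp (g := fun j => (i, j)) fun _ _ hj => (Prod.mk.inj hj).2).map_fun_eq_infinitePi_map
      fun j => hX (i, j)
  rw [iIndepFun_iff_map_fun_eq_infinitePi_map
    fun i => measurable_pi_lambda _ fun j => hX (i, j)]
  simp_rw [hrow]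
  rw [← Measure.infinitePi_map_curry (fun i j => μ.map (X (i, j))),
    ← h.map_fun_eq_infinitePi_map hX, Measure.map_map (by fun_prop) (by fun_prop)]
  rfl

end Independence

/-! ### The Gaussian limit and its image under the statistic. -/

section Limit

open scoped MatrixOrder

variable {d B : ℕ} {C : Matrix (Fin d) (Fin d) ℝ}

lemma multivariateGaussian_coord_eq (hC : C.PosDef) (i : Fin d) (c : ℝ) :
    multivariateGaussian 0 C {z | z i = c} = 0 := by
  have hmp := measurePreserving_eval_multivariateGaussian (μ := 0) hC.posSemidef (i := i)
  have := nullSingletonClass_gaussianReal (μ := (0 : EuclideanSpace ℝ (Fin d)) i)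
    (v := (C i i).toNNReal) (Real.toNNReal_pos.2 hC.diag_pos).ne'
  exact (hmp.measure_preimage (measurableSet_singleton c).nullMeasurableSet).trans
    (measure_singleton c)

/-- On the frontier some coordinate equals its bound, and each coordinate is Gaussian with variance
`C i i > 0`. -/
lemma frontier_orthant_null (hC : C.PosDef) (x : EuclideanSpace ℝ (Fin d)) :
    multivariateGaussian 0 C (frontier {z | ∀ i, z i ≤ x i}) = 0 := by
  refine measure_mono_null (t := ⋃ i, {z : EuclideanSpace ℝ (Fin d) | z i = x i}) ?_
    (measure_iUnion_null fun i => multivariateGaussian_coord_eq hC i (x i))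
  intro z hz
  have hclosed : IsClosed {z : EuclideanSpace ℝ (Fin d) | ∀ i, z i ≤ x i} := by
    simp only [Set.ofPred_forall]
    exact isClosed_iInter fun i => isClosed_le (by fun_prop) continuous_const
  have hopen : IsOpen {z : EuclideanSpace ℝ (Fin d) | ∀ i, z i < x i} := by
    simp only [Set.ofPred_forall]
    exact isOpen_iInter_of_finite fun i => isOpen_lt (by fun_prop) continuous_const
  by_contra hcon
  simp only [Set.mem_iUnion, not_exists] at hcon
  have hz1 : ∀ i, z i ≤ x i := hclosed.frontier_subset hz
  exact hz.2 (interior_maximal (fun y hy i => (hy i).le) hopen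
    fun i => lt_of_le_of_ne (hz1 i) (hcon i))

lemma exists_multivariateGaussian_eq_map (hC : C.PosDef) :
    ∃ A : Matrix (Fin d) (Fin d) ℝ, IsUnit A.det ∧ multivariateGaussian 0 C =
      (stdGaussian (EuclideanSpace ℝ (Fin d))).map fun u => WithLp.toLp 2 (A *ᵥ u.ofLp) := by
  refine ⟨CFC.sqrt C, ?_, ?_⟩
  · have h : (CFC.sqrt C).det * (CFC.sqrt C).det = C.det := by
      rw [← Matrix.det_mul, CFC.sqrt_mul_sqrt_self C hC.posSemidef.nonneg]
    exact isUnit_iff_ne_zero.2 fun h0 => hC.det_pos.ne' (by rw [← h, h0, zero_mul])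
  · rw [multivariateGaussian]
    congr 1
    ext u i
    simp [Matrix.ofLp_toEuclideanCLM]

lemma exists_prod_multivariateGaussian_eq_map (B : ℕ) (hC : C.PosDef) :
    ∃ A : Matrix (Fin d) (Fin d) ℝ, IsUnit A.det ∧
      (multivariateGaussian 0 C).prod (Measure.pi fun _ : Fin B => multivariateGaussian 0 C) =
        ((stdGaussian (EuclideanSpace ℝ (Fin d))).prod
          (Measure.pi fun _ : Fin B => stdGaussian (EuclideanSpace ℝ (Fin d)))).map
        fun p => (WithLp.toLp 2 (A *ᵥ p.1.ofLp), fun b => WithLp.toLp 2 (A *ᵥ (p.2 b).ofLp)) := by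
  obtain ⟨A, hA, hmap⟩ := exists_multivariateGaussian_eq_map hC
  have hmeas : Measurable fun u : EuclideanSpace ℝ (Fin d) =>
      (WithLp.toLp 2 (A *ᵥ u.ofLp) : EuclideanSpace ℝ (Fin d)) := by
    have : Continuous fun u : EuclideanSpace ℝ (Fin d) => A *ᵥ u.ofLp :=
      continuous_const.matrix_mulVec (by fun_prop)
    exact (PiLp.continuous_toLp 2 _ |>.comp this).measurable
  have hprob : IsProbabilityMeasure ((stdGaussian (EuclideanSpace ℝ (Fin d))).map
      fun u => (WithLp.toLp 2 (A *ᵥ u.ofLp) : EuclideanSpace ℝ (Fin d))) :=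
    Measure.isProbabilityMeasure_map hmeas.aemeasurable
  refine ⟨A, hA, ?_⟩
  rw [hmap, ← Measure.pi_map_pi fun _ => hmeas.aemeasurable]
  exact Measure.map_prod_map _ _ hmeas
    (measurable_pi_lambda _ fun b => hmeas.comp (measurable_pi_apply b))

lemma measurable_map_mulVec (A : Matrix (Fin d) (Fin d) ℝ) :
    Measurable fun p : EuclideanSpace ℝ (Fin d) × (Fin B → EuclideanSpace ℝ (Fin d)) =>
      ((WithLp.toLp 2 (A *ᵥ p.1.ofLp), fun b => WithLp.toLp 2 (A *ᵥ (p.2 b).ofLp)) :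
        EuclideanSpace ℝ (Fin d) × (Fin B → EuclideanSpace ℝ (Fin d))) := by
  have hcont : Continuous fun u : EuclideanSpace ℝ (Fin d) =>
      (WithLp.toLp 2 (A *ᵥ u.ofLp) : EuclideanSpace ℝ (Fin d)) :=
    (PiLp.continuous_toLp 2 _).comp (continuous_const.matrix_mulVec (by fun_prop))
  exact (hcont.measurable.comp measurable_fst).prodMk (measurable_pi_lambda _ fun b =>
    hcont.measurable.comp ((measurable_pi_apply b).comp measurable_snd))

/-- The limit law of the (scaled) point and resample estimates. -/
noncomputable abbrev jointLimit (C : Matrix (Fin d) (Fin d) ℝ) (B : ℕ) :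
    Measure (EuclideanSpace ℝ (Fin d) × (Fin B → EuclideanSpace ℝ (Fin d))) :=
  (multivariateGaussian 0 C).prod (Measure.pi fun _ : Fin B => multivariateGaussian 0 C)

/-- The statistic is pivotal: the same matrix `A` turns all `B + 1` standard vectors into the limit
vectors, and it cancels. -/
lemma map_invForm_jointLimit (hC : C.PosDef) :
    (jointLimit C B).map (fun p => invForm (secondMoment p.2) p.1) = hotelling d B := by
  obtain ⟨A, hA, hmap⟩ := exists_prod_multivariateGaussian_eq_map B hC
  rw [jointLimit, hmap, Measure.map_map measurable_invForm_secondMoment (measurable_map_mulVec A),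
    hotelling]
  congr 1
  funext p
  exact invForm_secondMoment_mulVec hA p.2 p.1

lemma jointLimit_not_isUnit_det (hC : C.PosDef) (hd : 1 ≤ d) (hB : d ≤ B) :
    jointLimit C B {p | ¬ IsUnit (secondMoment p.2).det} = 0 := by
  obtain ⟨A, hA, hmap⟩ := exists_prod_multivariateGaussian_eq_map B hC
  have hmeas : MeasurableSet {p : EuclideanSpace ℝ (Fin d) × (Fin B → EuclideanSpace ℝ (Fin d)) |
      ¬ IsUnit (secondMoment p.2).det} := by
    simp only [isUnit_iff_ne_zero, not_not]
    exact continuous_det_secondMoment.measurable (measurableSet_singleton 0)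
  rw [jointLimit, hmap, Measure.map_apply (measurable_map_mulVec A) hmeas,
    measure_eq_zero_iff_ae_notMem]
  filter_upwards [Measure.quasiMeasurePreserving_snd.ae (ae_secondMoment_posDef hd hB)] with p hp
  exact not_not.2 ((isUnit_det_secondMoment_mulVec hA p.2).2
    (isUnit_iff_ne_zero.2 hp.det_pos.ne'))

lemma jointLimit_frontier (hC : C.PosDef) (hd : 1 ≤ d) (hB : d ≤ B) (q : ℝ) :
    jointLimit C B (frontier {p | invForm (secondMoment p.2) p.1 ≤ q}) = 0 := by
  refine measure_mono_null (frontier_invForm_le_subset q)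
    (measure_union_null (jointLimit_not_isUnit_det hC hd hB) ?_)
  have := nullSingletonClass_hotelling hd hB
  have h := measure_singleton (μ := hotelling d B) q
  rwa [← map_invForm_jointLimit hC, Measure.map_apply measurable_invForm_secondMoment
    (measurableSet_singleton q)] at h

lemma jointLimit_real_invForm_le (hC : C.PosDef) (q : ℝ) :
    (jointLimit C B).real {p | invForm (secondMoment p.2) p.1 ≤ q} =
      (hotelling d B).real (Set.Iic q) := by
  rw [← map_invForm_jointLimit hC,
    map_measureReal_apply measurable_invForm_secondMoment measurableSet_Iic]
  rfl

end Limit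

/-! ### From orthant probabilities to joint convergence in distribution. -/

section Joint

variable {Ω : Type*} [MeasurableSpace Ω] {μ : Measure Ω} [IsProbabilityMeasure μ] {d B : ℕ}

/-- Convergence of the joint distribution functions to a product distribution function implies
joint convergence in distribution to the product measure. -/
lemma tendstoInDistribution_prod_of_orthants {ι : Type*} {l : Filter ι} [l.IsCountablyGenerated]
    {N : Measure (EuclideanSpace ℝ (Fin d))} [IsProbabilityMeasure N]
    {U : ι → Ω → EuclideanSpace ℝ (Fin d)} {D : ι → Fin B → Ω → EuclideanSpace ℝ (Fin d)}
    (hU : ∀ n, Measurable (U n)) (hD : ∀ n b, Measurable (D n b))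
    (h : ∀ (x : EuclideanSpace ℝ (Fin d)) (y : Fin B → EuclideanSpace ℝ (Fin d)),
      Tendsto (fun n => μ.real {ω | (∀ i, U n ω i ≤ x i) ∧ ∀ b i, D n b ω i ≤ y b i}) l
        (𝓝 (N.real {z | ∀ i, z i ≤ x i} * ∏ b, N.real {z | ∀ i, z i ≤ y b i}))) :
    TendstoInDistribution (fun n ω => (U n ω, fun b => D n b ω)) l id (fun _ => μ)
      (N.prod (Measure.pi fun _ : Fin B => N)) := by
  -- Listing all coordinates in one vector turns a joint orthant into a single `Iic`.
  let flat : EuclideanSpace ℝ (Fin d) × (Fin B → EuclideanSpace ℝ (Fin d)) →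
      (Fin d ⊕ Fin B × Fin d → ℝ) := fun p => Sum.elim (fun i => p.1 i) fun q => p.2 q.1 q.2
  let unflat : (Fin d ⊕ Fin B × Fin d → ℝ) →
      EuclideanSpace ℝ (Fin d) × (Fin B → EuclideanSpace ℝ (Fin d)) := fun z =>
    (WithLp.toLp 2 fun i => z (Sum.inl i), fun b => WithLp.toLp 2 fun i => z (Sum.inr (b, i)))
  have hflat : Measurable flat := by
    refine measurable_pi_lambda _ fun k => ?_
    rcases k with i | ⟨b, i⟩
    · change Measurable fun p : EuclideanSpace ℝ (Fin d) × (Fin B → EuclideanSpace ℝ (Fin d)) =>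
        p.1 i
      fun_prop
    · change Measurable fun p : EuclideanSpace ℝ (Fin d) × (Fin B → EuclideanSpace ℝ (Fin d)) =>
        p.2 b i
      fun_prop
  have hunflat : Continuous unflat := by fun_prop
  have hpair : ∀ n, Measurable fun ω => (U n ω, fun b => D n b ω) := fun n =>
    (hU n).prodMk (measurable_pi_lambda _ (hD n))
  have hconv : TendstoInDistribution (fun n ω => flat (U n ω, fun b => D n b ω)) l flat
      (fun _ => μ) (N.prod (Measure.pi fun _ : Fin B => N)) := by
    refine ⟨fun n => (hflat.comp (hpair n)).aemeasurable, hflat.aemeasurable, ?_⟩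
    refine tendsto_probabilityMeasure_of_tendsto_Iic fun z => ?_
    have hlim := h (unflat z).1 (unflat z).2
    have h1 : ∀ n, (μ.map fun ω => flat (U n ω, fun b => D n b ω)).real (Set.Iic z) =
        μ.real {ω | (∀ i, U n ω i ≤ (unflat z).1 i) ∧ ∀ b i, D n b ω i ≤ (unflat z).2 b i} := by
      intro n
      refine (map_measureReal_apply (hflat.comp (hpair n)) measurableSet_Iic).trans ?_
      congr 1
      ext ω
      simp [flat, unflat, Pi.le_def]
    have h2 : ((N.prod (Measure.pi fun _ : Fin B => N)).map flat).real (Set.Iic z) =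
        N.real {w | ∀ i, w i ≤ (unflat z).1 i} *
          ∏ b, N.real {w | ∀ i, w i ≤ (unflat z).2 b i} := by
      rw [map_measureReal_apply hflat measurableSet_Iic]
      have hset : flat ⁻¹' Set.Iic z = {w | ∀ i, w i ≤ (unflat z).1 i} ×ˢ
          Set.univ.pi fun b => {w | ∀ i, w i ≤ (unflat z).2 b i} := by
        ext p
        simp [flat, unflat, Pi.le_def]
      rw [hset, measureReal_prod_prod]
      simp [measureReal_def, Measure.pi_pi, ENNReal.toReal_prod]
    change Tendsto (fun n => (μ.map fun ω => flat (U n ω, fun b => D n b ω)).real (Set.Iic z)) l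
      (𝓝 (((N.prod (Measure.pi fun _ : Fin B => N)).map flat).real (Set.Iic z)))
    simp_rw [h1, h2]
    exact hlim
  -- Continuous mapping returns to the original space, as `unflat ∘ flat` is the identity.
  exact hconv.continuous_comp hunflat

lemma tendsto_measureReal_of_null_frontier {ι Ω' E : Type*} {l : Filter ι} [MeasurableSpace Ω']
    {μ' : Measure Ω'} [IsProbabilityMeasure μ'] [TopologicalSpace E] [MeasurableSpace E]
    [OpensMeasurableSpace E] [HasOuterApproxClosed E] {Z : ι → Ω → E} {W : Ω' → E}
    (h : TendstoInDistribution Z l W (fun _ => μ) μ') {S : Set E} (hS : MeasurableSet S)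
    (hfr : μ'.map W (frontier S) = 0) :
    Tendsto (fun n => μ.real (Z n ⁻¹' S)) l (𝓝 ((μ'.map W).real S)) := by
  have key := ProbabilityMeasure.tendsto_measure_of_null_frontier_of_tendsto' h.tendsto hfr
  have key' := (ENNReal.tendsto_toReal (measure_ne_top (μ'.map W) S)).comp key
  refine key'.congr fun n => ?_
  change ((μ.map (Z n)) S).toReal = _
  rw [Measure.map_apply_of_aemeasurable (h.forall_aemeasurable n) hS]
  rfl

end Joint

/-! ### Joint convergence of the point and resample estimates. -/

section Bootstrap

variable {𝒳 Ω : Type*} [MeasurableSpace 𝒳] [MeasurableSpace Ω] {μ : Measure Ω} {d B : ℕ}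
  {ψ : ProbabilityMeasure 𝒳 → EuclideanSpace ℝ (Fin d)}
  {X : ℕ → Ω → 𝒳} {J : (n : ℕ+) → Fin B → Fin n → Ω → Fin n}

lemma measurable_data (hX : ∀ i, Measurable (X i)) (n : ℕ+) : Measurable (data X n) :=
  measurable_pi_lambda _ fun i => hX i

/-- There are finitely many index maps, so it suffices to fix one; resampling is then a measurable
rearrangement of the data. -/
lemma measurable_empirical_resample
    (hψ : ∀ n : ℕ+, Measurable fun x : Fin n → 𝒳 => ψ (empirical x)) (n : ℕ+) :
    Measurable fun p : (Fin n → 𝒳) × (Fin n → Fin n) =>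
      ψ (empirical fun i : Fin n => p.1 (p.2 i)) :=
  measurable_from_prod_countable_left fun j =>
    (hψ n).comp (measurable_pi_lambda _ fun i => measurable_pi_apply (j i))

lemma measurable_estimate
    (hψ : ∀ n : ℕ+, Measurable fun x : Fin n → 𝒳 => ψ (empirical x))
    (hX : ∀ i, Measurable (X i)) (n : ℕ+) : Measurable (estimate ψ X n) :=
  (hψ n).comp (measurable_data hX n)

lemma IsResampling.measurable_row (hJ : IsResampling μ X J) (n : ℕ+) (b : Fin B) :
    Measurable fun ω i => J n b i ω :=
  measurable_pi_lambda _ fun i => hJ.measurable n b i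

lemma measurable_resampleEstimate
    (hψ : ∀ n : ℕ+, Measurable fun x : Fin n → 𝒳 => ψ (empirical x))
    (hX : ∀ i, Measurable (X i)) (hJ : IsResampling μ X J) (n : ℕ+) (b : Fin B) :
    Measurable (resampleEstimate ψ X J n b) := by
  have hpair : Measurable fun ω => (data X n ω, fun i => J n b i ω) :=
    (measurable_data hX n).prodMk (hJ.measurable_row n b)
  have h := (measurable_empirical_resample hψ n).comp hpair
  rw [Function.comp_def] at h
  exact h

lemma IsResampling.iIndepFun_row [IsProbabilityMeasure μ] (hJ : IsResampling μ X J) (n : ℕ+) :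
    iIndepFun (fun b ω i => J n b i ω) μ :=
  iIndepFun_curry (X := fun p : Fin B × Fin n => J n p.1 p.2)
    (fun p => hJ.measurable n p.1 p.2) (hJ.indep n)

lemma IsResampling.indepFun_data_row (hJ : IsResampling μ X J) (n : ℕ+) :
    IndepFun (data X n) (fun ω b i => J n b i ω) μ := by
  have hcurry : Measurable fun (k : Fin B × Fin n → Fin n) b i => k (b, i) :=
    measurable_pi_lambda _ fun b => measurable_pi_lambda _ fun i => measurable_pi_apply (b, i)
  exact (hJ.indep_data n).comp measurable_id hcurry

lemma measurableSet_orthant (x : EuclideanSpace ℝ (Fin d)) :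
    MeasurableSet {z : EuclideanSpace ℝ (Fin d) | ∀ i, z i ≤ x i} := by
  simp only [Set.ofPred_forall]
  exact MeasurableSet.iInter fun i => measurableSet_le (by fun_prop) measurable_const

/-- The point estimate and the resample estimates, centered and scaled, converge jointly to
independent normal vectors. -/
theorem tendstoInDistribution_estimates [IsProbabilityMeasure μ]
    (hψ : ∀ n : ℕ+, Measurable fun x : Fin n → 𝒳 => ψ (empirical x))
    (hX : ∀ i, Measurable (X i)) (hJ : IsResampling μ X J) {θ : EuclideanSpace ℝ (Fin d)}
    {C : Matrix (Fin d) (Fin d) ℝ} (hC : C.PosDef)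
    (hclt : TendstoInDistribution (fun (n : ℕ+) ω => √(n : ℝ) • (estimate ψ X n ω - θ)) atTop
      id (fun _ => μ) (multivariateGaussian 0 C))
    (hboot : ∀ b : Fin B, CondTendstoInDistribution μ
      (fun n ω => √(n : ℝ) • (resampleEstimate ψ X J n b ω - estimate ψ X n ω))
      (dataSigma X) (multivariateGaussian 0 C)) :
    TendstoInDistribution (fun (n : ℕ+) ω => (√(n : ℝ) • (estimate ψ X n ω - θ),
      fun b => √(n : ℝ) • (resampleEstimate ψ X J n b ω - estimate ψ X n ω))) atTop
      id (fun _ => μ) (jointLimit C B) := by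
  have hest := measurable_estimate hψ hX
  have hres := measurable_resampleEstimate hψ hX hJ
  refine tendstoInDistribution_prod_of_orthants (fun n => ((hest n).sub_const θ).fun_const_smul _)
    (fun n b => ((hres n b).fun_sub (hest n)).fun_const_smul _) fun x y => ?_
  have hA : Tendsto (fun n : ℕ+ => μ.real {ω | ∀ i, (√(n : ℝ) • (estimate ψ X n ω - θ)) i ≤ x i})
      atTop (𝓝 ((multivariateGaussian 0 C).real {z | ∀ i, z i ≤ x i})) := by
    have h := tendsto_measureReal_of_null_frontier hclt (measurableSet_orthant x)
      (by rw [Measure.map_id]; exact frontier_orthant_null hC x)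
    rwa [Measure.map_id] at h
  have hDset : ∀ (n : ℕ+) b, MeasurableSet {ω | ∀ i,
      (√(n : ℝ) • (resampleEstimate ψ X J n b ω - estimate ψ X n ω)) i ≤ y b i} := fun n b =>
    (((hres n b).fun_sub (hest n)).const_smul (√(n : ℝ))) (measurableSet_orthant (y b))
  -- The event on the point estimate is the set of integration; the factors are the conditional
  -- distribution functions of the resample estimates.
  have hlim := tendsto_setIntegral_prod hA
    (F := fun b n => μ⟦{ω | ∀ i,
      (√(n : ℝ) • (resampleEstimate ψ X J n b ω - estimate ψ X n ω)) i ≤ y b i} | dataSigma X n⟧)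
    (fun b n => integrable_condExp.aestronglyMeasurable)
    (fun b n => by
      refine ae_bdd_abs_condExp_of_ae_bdd_abs (R := 1) (ae_of_all _ fun ω => ?_)
      rw [← Real.norm_eq_abs]
      exact (norm_indicator_le_norm_self _ _).trans (by simp))
    (fun b => by rw [abs_of_nonneg measureReal_nonneg]; exact measureReal_le_one)
    (fun b => hboot b (y b))
  refine hlim.congr fun n => ?_
  -- The same events written through the data vector and the index rows, so that the Fubini identity
  -- applies.
  let T : Set (Fin n → 𝒳) := {z | ∀ i, (√(n : ℝ) • (ψ (empirical z) - θ)) i ≤ x i}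
  have hT : MeasurableSet T :=
    (((hψ n).sub_const θ).const_smul (√(n : ℝ))) (measurableSet_orthant x)
  let s : Fin B → Set ((Fin n → 𝒳) × (Fin n → Fin n)) := fun b => {p | ∀ i,
    (√(n : ℝ) • (ψ (empirical fun i : Fin n => p.1 (p.2 i)) - ψ (empirical p.1))) i ≤ y b i}
  have hs : ∀ b, MeasurableSet (s b) := fun b =>
    (((measurable_empirical_resample hψ n).fun_sub ((hψ n).comp measurable_fst)).const_smul
      (√(n : ℝ))) (measurableSet_orthant (y b))
  exact (measureReal_inter_eq_setIntegral_prod_condExp (measurable_data hX n)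
    (hJ.measurable_row n) (hJ.iIndepFun_row n) (hJ.indepFun_data_row n) hT hs).symm

end Bootstrap

/-! ### Rescaling the region by `√n`, and the event of invertibility. -/

section Conclusion

variable {𝒳 Ω : Type*} [MeasurableSpace 𝒳] {d B : ℕ}
  {ψ : ProbabilityMeasure 𝒳 → EuclideanSpace ℝ (Fin d)} {X : ℕ → Ω → 𝒳}
  {J : (n : ℕ+) → Fin B → Fin n → Ω → Fin n}

lemma isUnit_det_resampleCov (n : ℕ+) (ω : Ω) :
    IsUnit (resampleCov ψ X J n ω).det ↔ IsUnit (secondMoment fun b : Fin B =>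
      √(n : ℝ) • (resampleEstimate ψ X J n b ω - estimate ψ X n ω)).det :=
  (isUnit_det_secondMoment_smul (Real.sqrt_pos.2 (Nat.cast_pos.2 n.pos)).ne' _).symm

lemma mem_region_iff (α : ℝ) (n : ℕ+) (ω : Ω) (θ : EuclideanSpace ℝ (Fin d)) :
    θ ∈ region ψ X J α n ω ↔
      invForm (secondMoment fun b : Fin B =>
          √(n : ℝ) • (resampleEstimate ψ X J n b ω - estimate ψ X n ω))
        (√(n : ℝ) • (estimate ψ X n ω - θ)) ≤ quantile (hotelling d B) (1 - α) := by
  rw [invForm_secondMoment_smul (Real.sqrt_pos.2 (Nat.cast_pos.2 n.pos)).ne']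
  rfl

/-- Invertibility is an open condition, so its frontier consists of singular points. -/
lemma jointLimit_frontier_isUnit_det {C : Matrix (Fin d) (Fin d) ℝ} (hC : C.PosDef) (hd : 1 ≤ d)
    (hB : d ≤ B) : jointLimit C B (frontier {p | IsUnit (secondMoment p.2).det}) = 0 := by
  have hopen : IsOpen {p : EuclideanSpace ℝ (Fin d) × (Fin B → EuclideanSpace ℝ (Fin d)) |
      IsUnit (secondMoment p.2).det} := by
    simp only [isUnit_iff_ne_zero]
    exact isOpen_ne_fun continuous_det_secondMoment continuous_const
  refine measure_mono_null (fun p hp => ?_) (jointLimit_not_isUnit_det hC hd hB)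
  rw [hopen.frontier_eq] at hp
  exact hp.2

end Conclusion

end CheapBootstrap

theorem theorem8 {𝒳 Ω : Type*} [MeasurableSpace 𝒳] [MeasurableSpace Ω]
    (μ : Measure Ω) [IsProbabilityMeasure μ]
    (d B : ℕ) (hd : 1 ≤ d) (hB : d ≤ B)
    (P : ProbabilityMeasure 𝒳) (ψ : ProbabilityMeasure 𝒳 → EuclideanSpace ℝ (Fin d))
    (hψ : ∀ n : ℕ+, Measurable fun x : Fin n → 𝒳 => ψ (CheapBootstrap.empirical x))
    -- i.i.d. data with distribution `P`
    (X : ℕ → Ω → 𝒳) (hX : ∀ i, Measurable (X i)) (hXindep : iIndepFun X μ)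
    (hXlaw : ∀ i, μ.map (X i) = (P : Measure 𝒳))
    -- `B` resamples with replacement for every sample size
    (J : (n : ℕ+) → Fin B → Fin n → Ω → Fin n) (hJ : CheapBootstrap.IsResampling μ X J)
    -- asymptotic normality, unconditional and conditional on the data
    (C : Matrix (Fin d) (Fin d) ℝ) (hC : C.PosDef)
    (hclt : TendstoInDistribution
      (fun (n : ℕ+) ω => √(n : ℝ) • (CheapBootstrap.estimate ψ X n ω - ψ P)) atTop
      id (fun _ => μ) (multivariateGaussian 0 C))
    (hboot : ∀ b : Fin B, CheapBootstrap.CondTendstoInDistribution μ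
      (fun n ω => √(n : ℝ) •
        (CheapBootstrap.resampleEstimate ψ X J n b ω - CheapBootstrap.estimate ψ X n ω))
      (CheapBootstrap.dataSigma X) (multivariateGaussian 0 C))
    (α : ℝ) (hα0 : 0 < α) (hα1 : α < 1) :
    Tendsto (fun n : ℕ+ => μ.real {ω | IsUnit (CheapBootstrap.resampleCov ψ X J n ω).det})
        atTop (𝓝 1) ∧
      Tendsto (fun n : ℕ+ => μ.real {ω | ψ P ∈ CheapBootstrap.region ψ X J α n ω})
        atTop (𝓝 (1 - α)) := by
  have hjoint := CheapBootstrap.tendstoInDistribution_estimates hψ hX hJ hC hclt hboot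
  constructor
  · have hmeas : MeasurableSet
        {p : EuclideanSpace ℝ (Fin d) × (Fin B → EuclideanSpace ℝ (Fin d)) |
          IsUnit (CheapBootstrap.secondMoment p.2).det} := by
      simp only [isUnit_iff_ne_zero]
      exact CheapBootstrap.continuous_det_secondMoment.measurable
        (measurableSet_singleton 0).compl
    have h := CheapBootstrap.tendsto_measureReal_of_null_frontier hjoint hmeas (by
      rw [Measure.map_id]
      exact CheapBootstrap.jointLimit_frontier_isUnit_det hC hd hB)
    have hone : (CheapBootstrap.jointLimit C B).real
        {p | IsUnit (CheapBootstrap.secondMoment p.2).det} = 1 := by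
      have h0 : (CheapBootstrap.jointLimit C B).real
          {p | IsUnit (CheapBootstrap.secondMoment p.2).det}ᶜ = 0 := by
        rw [measureReal_def]
        exact (ENNReal.toReal_eq_zero_iff _).2
          (Or.inl (CheapBootstrap.jointLimit_not_isUnit_det hC hd hB))
      rw [probReal_compl_eq_one_sub hmeas] at h0
      linarith
    rw [Measure.map_id, hone] at h
    simp_rw [CheapBootstrap.isUnit_det_resampleCov]
    exact h
  · have hmeas : MeasurableSet
        {p : EuclideanSpace ℝ (Fin d) × (Fin B → EuclideanSpace ℝ (Fin d)) |
          CheapBootstrap.invForm (CheapBootstrap.secondMoment p.2) p.1 ≤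
            CheapBootstrap.quantile (CheapBootstrap.hotelling d B) (1 - α)} :=
      CheapBootstrap.measurable_invForm_secondMoment measurableSet_Iic
    have h := CheapBootstrap.tendsto_measureReal_of_null_frontier hjoint hmeas (by
      rw [Measure.map_id]
      exact CheapBootstrap.jointLimit_frontier hC hd hB _)
    -- Without atoms the distribution function takes the value `1 - α` exactly at the quantile,
    -- instead of merely being at least `1 - α`.
    have := CheapBootstrap.nullSingletonClass_hotelling hd hB
    rw [Measure.map_id, CheapBootstrap.jointLimit_real_invForm_le hC,
      CheapBootstrap.measureReal_Iic_quantile _ (by linarith) (by linarith)] at h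
    simp_rw [CheapBootstrap.mem_region_iff]
    exact h
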